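/- Let $\mathbb V$ be a finite-dimensional Euclidean Jordan algebra: a finite-dimensional real inner-product space with a commutative bilinear product $\circ$ and identity element $e$ such that $x^2\circ(x\circ y)=x\circ(x^2\circ y)$ and $\langle x,y\circ z\rangle=\langle x\circ y,z\rangle$ for all $x,y,z$ (for example with the trace inner product $\langle x,y\rangle=\operatorname{tr}(x\circ y)$). Let $\mathcal K_1=\{y\circ y:y\in\mathbb V\}$ be its cone of squares, $\mathcal C=\{x\in\mathcal K_1:\langle e,x\rangle=1\}$ and $\mathrm{ri}\,\mathcal C=\{x\in\mathrm{int}\,\mathcal K_1:\langle e,x\rangle=1\}$. Every $b\in\mathbb V$ has a spectral decomposition $b=\sum_{i}\lambda_i q_i$, where the $q_i$ are pairwise orthogonal primitive idempotents ($q_i\circ q_i=q_i$, $q_i\circ q_j=0$ for $i\neq j$) with $\sum_i q_i=e$. Write $\lambda_{\max}(b)=\max_i\lambda_i$ and, if $b\in\mathcal K_1$, $\ln b=\sum_{i:\lambda_i>0}\ln(\lambda_i)\,q_i$; for $b\in\mathrm{int}\,\mathcal K_1$ all $\lambda_i$ are positive and this is the usual $\ln b=\sum_i\ln(\lambda_i)q_i$.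 Let $\mathbb W$ be a finite-dimensional real vector space, $\mathcal K_2\subseteq\mathbb W$ a closed convex cone with nonempty interior that contains no line, with dual cone $\mathcal K_2^*$. Let $\mathsf A:\mathbb V\to\mathbb W$ be linear with $\mathsf A(\mathcal K_1)\subseteq\mathcal K_2$, $\mathsf A(\mathrm{int}\,\mathcal K_1)\subseteq\mathrm{int}\,\mathcal K_2$ and $\mathsf A^*(\mathrm{int}\,\mathcal K_2^*)\subseteq\mathrm{int}\,\mathcal K_1$. Let $f:\mathcal K_2\to\mathbb R\cup\{-\infty\}$ be concave and, on $\mathrm{int}\,\mathcal K_2$, finite, three times differentiable and $1$-logarithmically homogeneous: $f(ty)=f(y)+\ln t$ for all $t>0$ and $y\in\mathrm{int}\,\mathcal K_2$. Consider $$\max\ F(x):=f(\mathsf Ax)\quad\text{subject to } x\in\mathcal C,$$ let $\mathcal X^*$ be its set of optimal solutions, and for $x^*\in\mathcal X^*$ let $\delta(x)=F(x^*)-F(x)$, which does not depend on $x^*$. Then for every $x\in\mathrm{ri}\,\mathcal C$ we have $\nabla F(x)\in\mathcal K_1$ and, with $\ln 0:=-\infty$ for the logarithm of a number, $$\delta(x)\le\ln\langle\nabla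 F(x),x^*\rangle\quad\text{for every }x^*\in\mathcal X^*,$$ $$\delta(x)\le\max_{u\in\mathcal C}\ln\langle\nabla F(x),u\rangle=\ln\lambda_{\max}(\nabla F(x))=\max_{u\in\mathcal C}\langle\ln\nabla F(x),u\rangle,$$ where both maxima are attained, and the two equalities hold whether or not $\mathcal X^*$ is empty. -/

import Mathlib

open scoped RealInnerProductSpace

noncomputable section

/-- A Euclidean Jordan algebra structure on a real inner product space: a commutative bilinear
product with identity element `e` that satisfies the Jordan identity and for which the inner
product is associative. The trace inner product `⟪x, y⟫ = tr (x ∘ y)` is an instance. -/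
class EuclideanJordanAlgebra (V : Type*) [NormedAddCommGroup V] [InnerProductSpace ℝ V] where
  /-- the Jordan product -/
  jmul : V →ₗ[ℝ] V →ₗ[ℝ] V
  /-- the identity element -/
  e : V
  jmul_comm : ∀ x y : V, jmul x y = jmul y x
  jordan : ∀ x y : V, jmul (jmul x x) (jmul x y) = jmul x (jmul (jmul x x) y)
  jmul_e : ∀ x : V, jmul x e = x
  inner_jmul : ∀ x y z : V, ⟪x, jmul y z⟫ = ⟪jmul x y, z⟫

namespace EuclideanJordanAlgebra

variable {V : Type*} [NormedAddCommGroup V] [InnerProductSpace ℝ V] [EuclideanJordanAlgebra V]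

variable (V) in
/-- The cone of squares `K = {y ∘ y}`. -/
def squareCone : Set V := {x | ∃ y : V, x = jmul y y}

variable (V) in
/-- The generalized unit simplex `C = {x ∈ K : ⟪e, x⟫ = 1}`. -/
def simplex : Set V := {x | x ∈ squareCone V ∧ ⟪(e : V), x⟫ = 1}

variable (V) in
/-- The relative interior `ri C = {x ∈ int K : ⟪e, x⟫ = 1}` of the generalized unit simplex. -/
def riSimplex : Set V := {x | x ∈ interior (squareCone V) ∧ ⟪(e : V), x⟫ = 1}

/-- A primitive idempotent: a nonzero idempotent that is not the sum of two nonzero orthogonal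
idempotents. -/
structure IsPrimitiveIdempotent (c : V) : Prop where
  ne_zero : c ≠ 0
  idem : jmul c c = c
  primitive : ∀ a b : V, jmul a a = a → jmul b b = b → jmul a b = 0 → a + b = c → a = 0 ∨ b = 0

/-- A Jordan frame: a complete system of pairwise orthogonal primitive idempotents. -/
structure IsJordanFrame {k : ℕ} (q : Fin k → V) : Prop where
  primitive : ∀ i, IsPrimitiveIdempotent (q i)
  orthogonal : ∀ i j, i ≠ j → jmul (q i) (q j) = 0
  complete : ∑ i, q i = e

/-- `x = ∑ i, lam i • q i` is a spectral decomposition of `x`. -/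
def IsSpectralDecomposition (x : V) {k : ℕ} (lam : Fin k → ℝ) (q : Fin k → V) : Prop :=
  IsJordanFrame q ∧ x = ∑ i, lam i • q i

/-- The set of eigenvalues of `x`: the coefficients in its spectral decompositions. -/
def eigenvalues (x : V) : Set ℝ :=
  {t | ∃ (k : ℕ) (lam : Fin k → ℝ) (q : Fin k → V),
    IsSpectralDecomposition x lam q ∧ ∃ i, lam i = t}

/-- The largest eigenvalue. -/
def lambdaMax (x : V) : ℝ := sSup (eigenvalues x)

open Classical in
/-- `g(x) = ∑ i, g (lam i) • q i` for a spectral decomposition `x = ∑ i, lam i • q i`. -/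
def spectralMap (g : ℝ → ℝ) (x : V) : V :=
  if h : ∃ d : (k : ℕ) × (Fin k → ℝ) × (Fin k → V), IsSpectralDecomposition x d.2.1 d.2.2 then
    ∑ i, g (h.choose.2.1 i) • h.choose.2.2 i
  else 0

/-- The logarithm of an element of the cone of squares. Since `Real.log 0 = 0`, the sum effectively
runs over the positive eigenvalues; on the interior of the cone these are all of them. -/
def jlog (x : V) : V := spectralMap Real.log x

end EuclideanJordanAlgebra

open EuclideanJordanAlgebra

/-- The natural logarithm with values in the extended reals, `ln 0 = -∞`. -/
def elog (t : ℝ) : EReal := ENNReal.log (ENNReal.ofReal t)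

/-- The data of the problem `max f (A x)` subject to `x ∈ C`, with `C` the generalized unit simplex
of `V`, a regular cone `K₂` in `W`, a linear operator `A`, and a concave, three times
differentiable, 1-logarithmically-homogeneous function `f` on `K₂` with values in `ℝ ∪ {-∞}`
(the values of `f` outside `K₂` play no role). -/
structure LogHomProblem (V W : Type*) [NormedAddCommGroup V] [InnerProductSpace ℝ V]
    [EuclideanJordanAlgebra V] [NormedAddCommGroup W] [NormedSpace ℝ W] where
  /-- the cone `K₂` -/
  K₂ : ConvexCone ℝ W
  K₂_closed : IsClosed (K₂ : Set W)
  K₂_salient : K₂.Salient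
  K₂_solid : (interior (K₂ : Set W)).Nonempty
  /-- the linear operator -/
  A : V →ₗ[ℝ] W
  A_mem : ∀ x ∈ squareCone V, A x ∈ K₂
  A_interior : ∀ x ∈ interior (squareCone V), A x ∈ interior (K₂ : Set W)
  /-- the adjoint `A*` maps the interior of the dual cone of `K₂` into the interior of `K₁`;
  here `a = A* φ` -/
  adjoint_interior : ∀ φ : W →L[ℝ] ℝ, φ ∈ interior {ψ : W →L[ℝ] ℝ | ∀ y ∈ K₂, 0 ≤ ψ y} →
    ∀ a : V, (∀ x : V, ⟪a, x⟫ = φ (A x)) → a ∈ interior (squareCone V)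
  /-- the function `f` -/
  f : W → EReal
  f_ne_top : ∀ y ∈ K₂, f y ≠ ⊤
  f_ne_bot : ∀ y ∈ interior (K₂ : Set W), f y ≠ ⊥
  f_concave : ∀ y ∈ K₂, ∀ z ∈ K₂, ∀ a b : ℝ, 0 < a → 0 < b → a + b = 1 →
    (a : EReal) * f y + (b : EReal) * f z ≤ f (a • y + b • z)
  f_diff : ∀ y ∈ interior (K₂ : Set W),
    DifferentiableAt ℝ (fun w => (f w).toReal) y ∧
    DifferentiableAt ℝ (fderiv ℝ (fun w => (f w).toReal)) y ∧
    DifferentiableAt ℝ (fderiv ℝ (fderiv ℝ (fun w => (f w).toReal))) y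
  f_logHom : ∀ y ∈ interior (K₂ : Set W), ∀ t : ℝ, 0 < t → f (t • y) = f y + (Real.log t : EReal)

namespace LogHomProblem

variable {V W : Type*} [NormedAddCommGroup V] [InnerProductSpace ℝ V]
  [EuclideanJordanAlgebra V] [NormedAddCommGroup W] [NormedSpace ℝ W]

/-- The objective `F(x) = f(A x)`. -/
def F (P : LogHomProblem V W) (x : V) : EReal := P.f (P.A x)

/-- The gradient of `F` with respect to the inner product of `V`. -/
def gradF [FiniteDimensional ℝ V] (P : LogHomProblem V W) (x : V) : V :=
  haveI : CompleteSpace V := FiniteDimensional.complete ℝ V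
  gradient (fun z => (P.F z).toReal) x

/-- The set of optimal solutions. -/
def optimalSet (P : LogHomProblem V W) : Set V :=
  {x | x ∈ simplex V ∧ ∀ u ∈ simplex V, P.F u ≤ P.F x}

/-- The sub-optimality gap `δ(x) = F(x*) - F(x)`, which is the same for all optimal `x*`. -/
def gap (P : LogHomProblem V W) (xstar x : V) : EReal := P.F xstar - P.F x

end LogHomProblem

end

open EuclideanJordanAlgebra

open EuclideanJordanAlgebra

/-! Write g = ∇F(x). Differentiating logarithmic homogeneity along the ray through Ax gives ⟨g, x⟩ =
1. The tangent inequality for the concave f at Ax, applied to a suitable positive multiple of Au,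
then becomes exp(f(Au) - f(Ax)) ≤ ⟨g, u⟩ (`exp_le_fderiv`). Taking logarithms bounds the gap.

The equalities are spectral. Idempotents pair nonnegatively with squares
(`inner_jmul_self_of_idem`), so on the simplex the functional ⟨∑ λᵢ qᵢ, ·⟩ is at most max λᵢ, with
equality at a normalized qᵢ. This applies both to g and to ln g. Since g is nonnegative on squares,
testing it on its own frame shows that its eigenvalues are nonnegative, so g is a square.

The spectral theorem rests on power associativity: the polynomials in `jmul x` applied to `e`
multiply like polynomials, and Lagrange interpolation on the spectrum of `jmul x` produces the
idempotents. -/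

namespace EuclideanJordanAlgebra

/-! ### Linearized Jordan identities and power associativity. -/

section Algebra

variable {V : Type*} [NormedAddCommGroup V] [InnerProductSpace ℝ V] [EuclideanJordanAlgebra V]

/-- The Jordan identity, linearized once. -/
theorem jordan_linearized (x y z : V) :
    (2 : ℝ) • jmul (jmul x z) (jmul x y) + jmul (jmul x x) (jmul z y) =
      jmul z (jmul (jmul x x) y) + (2 : ℝ) • jmul x (jmul (jmul x z) y) := by
  have h1 := jordan (x + z) y
  have h2 := jordan (x - z) y
  have h3 := jordan z y
  simp only [map_add, map_sub, LinearMap.add_apply, LinearMap.sub_apply, jmul_comm z x] at h1 h2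
  linear_combination (norm := module) (1 / 2 : ℝ) • h1 - (1 / 2 : ℝ) • h2 - h3

/-- The Jordan identity, linearized twice. -/
theorem jordan_polarized (x w y z : V) :
    jmul (jmul w z) (jmul x y) + jmul (jmul x z) (jmul w y) + jmul (jmul x w) (jmul z y) =
      jmul z (jmul (jmul x w) y) + jmul w (jmul (jmul x z) y) + jmul x (jmul (jmul w z) y) := by
  have h1 := jordan_linearized (x + w) y z
  have h2 := jordan_linearized x y z
  have h3 := jordan_linearized w y z
  simp only [map_add, LinearMap.add_apply, smul_add, jmul_comm w x] at h1
  linear_combination (norm := module) (1 / 2 : ℝ) • h1 - (1 / 2 : ℝ) • h2 - (1 / 2 : ℝ) • h3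

/-- For w = xⁿ this is a recursion for multiplication by xⁿ⁺² in terms of x, x², xⁿ and xⁿ⁺¹, which
drives the two-step induction in `commute_jmul_pow`. -/
theorem jmul_jmul_jmul_self (x w : V) :
    jmul (jmul x (jmul x w)) =
      jmul (jmul x x) * jmul w + (2 : ℝ) • (jmul (jmul x w) * jmul x)
        - jmul w * jmul x * jmul x - jmul x * jmul x * jmul w := by
  ext v
  have h := jordan_polarized x w x v
  rw [jmul_comm v (jmul (jmul x w) x), jmul_comm (jmul x w) x, jmul_comm w x, jmul_comm v x,
    jmul_comm (jmul w v), jmul_comm (jmul x v) (jmul x w), jmul_comm (jmul x v) x,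
    jmul_comm (jmul w v) x] at h
  simp only [LinearMap.add_apply, LinearMap.sub_apply, LinearMap.smul_apply, Module.End.mul_apply]
  linear_combination (norm := module) -h

theorem commute_jmul_jmul_self (x : V) : Commute (jmul x : Module.End ℝ V) (jmul (jmul x x)) := by
  ext v
  exact (jordan x v).symm

/-- Multiplication by a power of `x` commutes with multiplication by `x` and by `x ∘ x`. -/
theorem commute_jmul_pow (x : V) (n : ℕ) :
    Commute (jmul ((jmul x ^ n : Module.End ℝ V) e)) (jmul x : Module.End ℝ V) ∧
    Commute (jmul ((jmul x ^ n : Module.End ℝ V) e)) (jmul (jmul x x) : Module.End ℝ V) := by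
  have he : (jmul (e : V) : Module.End ℝ V) = 1 := by
    ext v
    rw [jmul_comm, jmul_e]
    rfl
  have hx := commute_jmul_jmul_self x
  induction n using Nat.twoStepInduction with
  | zero => simp [he]
  | one => simpa [jmul_e] using hx
  | more n h1 h2 =>
    rw [pow_succ', Module.End.mul_apply] at h2
    rw [pow_succ', pow_succ', Module.End.mul_apply, Module.End.mul_apply, jmul_jmul_jmul_self]
    obtain ⟨h1, h1'⟩ := h1
    obtain ⟨h2, h2'⟩ := h2
    constructor
    · exact (((hx.symm.mul_left h1).add_left ((h2.mul_left (Commute.refl _)).smul_left _)).sub_left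
        ((h1.mul_left (Commute.refl _)).mul_left (Commute.refl _))).sub_left
        (((Commute.refl _).mul_left (Commute.refl _)).mul_left h1)
    · exact ((((Commute.refl _).mul_left h1').add_left ((h2'.mul_left hx).smul_left _)).sub_left
        ((h1'.mul_left hx).mul_left hx)).sub_left ((hx.mul_left hx).mul_left h1')

/-- Euclidean Jordan algebras are power-associative. -/
theorem jmul_pow_pow (x : V) (m n : ℕ) :
    jmul ((jmul x ^ m : Module.End ℝ V) e) ((jmul x ^ n : Module.End ℝ V) e) =
      (jmul x ^ (m + n) : Module.End ℝ V) e := by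
  have h := ((commute_jmul_pow x m).1.pow_right n)
  have h' := congrArg (fun T : Module.End ℝ V => T e) h.eq
  simp only [Module.End.mul_apply, jmul_e] at h'
  rw [h', add_comm, pow_add, Module.End.mul_apply]

open Polynomial in
theorem jmul_aeval_aeval (x : V) (p q : ℝ[X]) :
    jmul (aeval (jmul x : Module.End ℝ V) p e) (aeval (jmul x : Module.End ℝ V) q e) =
      aeval (jmul x : Module.End ℝ V) (p * q) e := by
  induction p using Polynomial.induction_on' with
  | add p₁ p₂ h₁ h₂ => simp only [map_add, LinearMap.add_apply, add_mul, h₁, h₂]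
  | monomial m a =>
    induction q using Polynomial.induction_on' with
    | add q₁ q₂ h₁ h₂ => simp only [map_add, LinearMap.add_apply, mul_add, h₁, h₂]
    | monomial n b =>
      rw [monomial_mul_monomial]
      simp [aeval_monomial, Module.algebraMap_end_apply, jmul_pow_pow, smul_smul, mul_comm]

/-! ### Idempotents and their pairing with squares. -/

theorem inner_jmul_left (x y z : V) : ⟪jmul x y, z⟫ = ⟪y, jmul x z⟫ := by
  rw [inner_jmul, jmul_comm]

theorem isSymmetric_jmul (x : V) : (jmul x : Module.End ℝ V).IsSymmetric :=
  inner_jmul_left x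

theorem inner_e_of_idem {c : V} (hc : jmul c c = c) : ⟪e, c⟫ = ‖c‖ ^ 2 := by
  have h := inner_jmul_left c e c
  rw [jmul_e, hc] at h
  rw [← h, real_inner_self_eq_norm_sq]

/-- The operator of multiplication by an idempotent is a sum of squares. -/
theorem inner_jmul_self_of_idem {c : V} (hc : jmul c c = c) (y : V) :
    ⟪c, jmul y y⟫ = ‖jmul c y‖ ^ 2 + 4 * ‖jmul c y - jmul c (jmul c y)‖ ^ 2 := by
  have h := jmul_jmul_jmul_self c c
  rw [hc, hc] at h
  -- The symmetric operator L = `jmul c` satisfies 2L³ - 3L² + L = 0, so its eigenvalues lie in {0,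
  -- 1/2, 1}. On these, λ = λ² + 4(λ - λ²)², which explains the factor 4.
  have h1 : (2 : ℝ) • jmul c (jmul c (jmul c y)) = (3 : ℝ) • jmul c (jmul c y) - jmul c y := by
    have := congrArg (fun T : Module.End ℝ V => T y) h
    simp only [LinearMap.add_apply, LinearMap.sub_apply, LinearMap.smul_apply,
      Module.End.mul_apply] at this
    linear_combination (norm := module) this
  have h2 := congrArg (jmul c) h1
  simp only [map_smul, map_sub] at h2
  have k1 := congrArg (fun v => ⟪y, v⟫) h1
  have k2 := congrArg (fun v => ⟪y, v⟫) h2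
  simp only [inner_sub_right, real_inner_smul_right] at k1 k2
  rw [inner_jmul, ← real_inner_self_eq_norm_sq, ← real_inner_self_eq_norm_sq]
  simp only [inner_sub_right, inner_sub_left, inner_jmul_left]
  rw [real_inner_comm]
  have : ⟪jmul c y, y⟫ = ⟪y, jmul c y⟫ := real_inner_comm _ _
  linarith

theorem inner_idem_nonneg {c u : V} (hc : jmul c c = c) (hu : u ∈ squareCone V) : 0 ≤ ⟪c, u⟫ := by
  obtain ⟨y, rfl⟩ := hu
  rw [inner_jmul_self_of_idem hc]
  positivity

theorem idem_mem_squareCone {c : V} (hc : jmul c c = c) : c ∈ squareCone V := ⟨c, hc.symm⟩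

theorem jmul_eq_zero_of_inner_eq_zero {c d : V} (hc : jmul c c = c) (hd : jmul d d = d)
    (h : ⟪c, d⟫ = 0) : jmul c d = 0 := by
  have := inner_jmul_self_of_idem hc d
  rw [hd, h] at this
  have h0 : ‖jmul c d‖ ^ 2 = 0 := by
    have h1 := sq_nonneg (‖jmul c d‖)
    have h2 := sq_nonneg (‖jmul c d - jmul c (jmul c d)‖)
    linarith
  simpa using h0

theorem inner_eq_zero_of_jmul_eq_zero {c d : V} (hc : jmul c c = c) (h : jmul c d = 0) :
    ⟪c, d⟫ = 0 := by
  rw [← hc, inner_jmul_left, h, inner_zero_right]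

/-- The nonnegative numbers ⟨c, a⟩ and ⟨c, b⟩ sum to zero, so both vanish, and for idempotents this
forces the Jordan product to vanish. It keeps a system orthogonal when one member is split. -/
theorem jmul_eq_zero_of_jmul_add_eq_zero {a b c : V} (ha : jmul a a = a) (hb : jmul b b = b)
    (hc : jmul c c = c) (h : jmul c (a + b) = 0) : jmul c a = 0 := by
  have h0 := inner_eq_zero_of_jmul_eq_zero hc h
  rw [inner_add_right] at h0
  have h1 := inner_idem_nonneg hc (idem_mem_squareCone ha)
  have h2 := inner_idem_nonneg hc (idem_mem_squareCone hb)
  exact jmul_eq_zero_of_inner_eq_zero hc ha (by linarith)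

/-! ### Systems of idempotents and the spectral theorem. -/

/-- A complete system of nonzero, pairwise orthogonal idempotents. -/
structure IsIdempotentSystem {k : ℕ} (q : Fin k → V) : Prop where
  ne_zero : ∀ i, q i ≠ 0
  idem : ∀ i, jmul (q i) (q i) = q i
  orthogonal : ∀ i j, i ≠ j → jmul (q i) (q j) = 0
  complete : ∑ i, q i = e

theorem IsIdempotentSystem.card_le [FiniteDimensional ℝ V] {k : ℕ} {q : Fin k → V}
    (hq : IsIdempotentSystem q) : k ≤ Module.finrank ℝ V := by
  have : LinearIndependent ℝ q := linearIndependent_of_ne_zero_of_inner_eq_zero hq.ne_zero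
    fun i j hij => inner_eq_zero_of_jmul_eq_zero (hq.idem i) (hq.orthogonal i j hij)
  simpa using this.fintype_card_le_finrank

/-- Splitting one idempotent of a system into two orthogonal ones. -/
theorem IsIdempotentSystem.split {k : ℕ} {q : Fin k → V} (hq : IsIdempotentSystem q) (i : Fin k)
    {a b : V} (ha : jmul a a = a) (hb : jmul b b = b) (hab : jmul a b = 0) (hi : a + b = q i)
    (ha0 : a ≠ 0) (hb0 : b ≠ 0) :
    IsIdempotentSystem (Fin.cons a (Function.update q i b) : Fin (k + 1) → V) := by
  have hqa : ∀ j, j ≠ i → jmul (q j) a = 0 := fun j hj =>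
    jmul_eq_zero_of_jmul_add_eq_zero ha hb (hq.idem j) (hi ▸ hq.orthogonal j i hj)
  have hqb : ∀ j, j ≠ i → jmul (q j) b = 0 := fun j hj =>
    jmul_eq_zero_of_jmul_add_eq_zero hb ha (hq.idem j) (add_comm a b ▸ hi ▸ hq.orthogonal j i hj)
  have hau : ∀ j, jmul a (Function.update q i b j) = 0 := by
    intro j
    rcases eq_or_ne j i with rfl | hj
    · simpa using hab
    · rw [Function.update_of_ne hj, jmul_comm, hqa j hj]
  refine ⟨fun j => ?_, fun j => ?_, fun j l hjl => ?_, ?_⟩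
  · refine Fin.cases ha0 (fun j => ?_) j
    rcases eq_or_ne j i with rfl | hj
    · simpa using hb0
    · simpa [Function.update_of_ne hj] using hq.ne_zero j
  · refine Fin.cases ha (fun j => ?_) j
    rcases eq_or_ne j i with rfl | hj
    · simpa using hb
    · simpa [Function.update_of_ne hj] using hq.idem j
  · cases j using Fin.cases with
    | zero =>
      cases l using Fin.cases with
      | zero => exact absurd rfl hjl
      | succ l => simpa using hau l
    | succ j =>
      cases l using Fin.cases with
      | zero =>
        rw [jmul_comm]
        simpa using hau j
      | succ l =>
        have hne : j ≠ l := fun h => hjl (h ▸ rfl)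
        simp only [Fin.cons_succ]
        rcases eq_or_ne j i with rfl | hj
        · rw [Function.update_self, Function.update_of_ne hne.symm, jmul_comm, hqb l hne.symm]
        · rw [Function.update_of_ne hj]
          rcases eq_or_ne l i with rfl | hl
          · rw [Function.update_self, hqb j hj]
          · rw [Function.update_of_ne hl, hq.orthogonal j l hne]
  · rw [Fin.sum_univ_succ]
    simp only [Fin.cons_zero, Fin.cons_succ]
    rw [Finset.sum_update_of_mem (Finset.mem_univ i), ← add_assoc, hi, ← hq.complete,
      ← Finset.add_sum_erase _ q (Finset.mem_univ i), Finset.sdiff_singleton_eq_erase]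

omit [EuclideanJordanAlgebra V] in
theorem sum_smul_split {k : ℕ} (lam : Fin k → ℝ) (q : Fin k → V) (i : Fin k) {a b : V}
    (hi : a + b = q i) :
    ∑ j, (Fin.cons (lam i) lam : Fin (k + 1) → ℝ) j •
      (Fin.cons a (Function.update q i b) : Fin (k + 1) → V) j = ∑ j, lam j • q j := by
  rw [Fin.sum_univ_succ]
  simp only [Fin.cons_zero, Fin.cons_succ]
  rw [← Finset.add_sum_erase _ _ (Finset.mem_univ i),
    ← Finset.add_sum_erase _ (fun j => lam j • q j) (Finset.mem_univ i), Function.update_self,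
    ← add_assoc, ← smul_add, hi]
  congr 1
  exact Finset.sum_congr rfl fun j hj => by rw [Function.update_of_ne (Finset.ne_of_mem_erase hj)]

open Polynomial in
/-- Polynomials that agree on the eigenvalues of a symmetric operator agree on the operator. -/
theorem _root_.LinearMap.IsSymmetric.aeval_eq_of_eval_eq {E : Type*} [NormedAddCommGroup E]
    [InnerProductSpace ℝ E] [FiniteDimensional ℝ E] {T : Module.End ℝ E} (hT : T.IsSymmetric)
    {p q : ℝ[X]} (h : ∀ μ, T.HasEigenvalue μ → p.eval μ = q.eval μ) : aeval T p = aeval T q := by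
  refine (hT.eigenvectorBasis rfl).toBasis.ext fun i => ?_
  have hv := hT.hasEigenvector_eigenvectorBasis rfl i
  rw [OrthonormalBasis.coe_toBasis, Module.End.aeval_apply_of_hasEigenvector hv,
    Module.End.aeval_apply_of_hasEigenvector hv,
    h _ (Module.End.hasEigenvalue_of_hasEigenvector hv)]

-- The Lagrange basis polynomials on the spectrum of `jmul x` act there as indicator functions. By
-- `jmul_aeval_aeval`, applying them to `e` gives orthogonal idempotents, and interpolating 1 and X
-- recovers `e` and `x`.
open Polynomial in
theorem exists_idempotentSystem [FiniteDimensional ℝ V] (x : V) :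
    ∃ (k : ℕ) (lam : Fin k → ℝ) (q : Fin k → V), IsIdempotentSystem q ∧ x = ∑ i, lam i • q i := by
  classical
  set T : Module.End ℝ V := jmul x with hTdef
  have hT : T.IsSymmetric := isSymmetric_jmul x
  let s : Finset ℝ := (Module.End.finite_hasEigenvalue T).toFinset
  have hs : ∀ μ, μ ∈ s ↔ T.HasEigenvalue μ := fun μ => Set.Finite.mem_toFinset _
  have hinj : Set.InjOn (id : ℝ → ℝ) s := Function.injective_id.injOn
  let c : ℝ → V := fun μ => aeval T (Lagrange.basis s id μ) e
  have hmul : ∀ μ ∈ s, ∀ ν ∈ s, jmul (c μ) (c ν) = if μ = ν then c μ else 0 := by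
    intro μ hμ ν hν
    have h1 : aeval T (Lagrange.basis s id μ * Lagrange.basis s id ν) =
        aeval T (if μ = ν then Lagrange.basis s id μ else 0) := by
      refine hT.aeval_eq_of_eval_eq fun ρ hρ => ?_
      rw [← hs] at hρ
      rw [eval_mul]
      split_ifs with h
      · subst h
        rcases eq_or_ne μ ρ with rfl | hne
        · have := Lagrange.eval_basis_self hinj hμ
          simp only [id] at this
          rw [this, mul_one]
        · have := Lagrange.eval_basis_of_ne (v := (id : ℝ → ℝ)) hne hρ
          simp only [id] at this
          rw [this, mul_zero]
      · rcases eq_or_ne μ ρ with rfl | hne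
        · have := Lagrange.eval_basis_of_ne (v := (id : ℝ → ℝ)) (Ne.symm h) hρ
          simp only [id] at this
          rw [this, mul_zero, eval_zero]
        · have := Lagrange.eval_basis_of_ne (v := (id : ℝ → ℝ)) hne hρ
          simp only [id] at this
          rw [this, zero_mul, eval_zero]
    rw [jmul_aeval_aeval, ← hTdef, h1]
    split_ifs <;> simp [c]
  have hsum : ∑ μ ∈ s, c μ = e := by
    have h1 : aeval T (∑ μ ∈ s, Lagrange.basis s id μ) = aeval T (1 : ℝ[X]) := by
      refine hT.aeval_eq_of_eval_eq fun ρ hρ => ?_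
      rw [Lagrange.sum_basis hinj ⟨ρ, (hs ρ).2 hρ⟩]
    have h2 := congrArg (fun S : Module.End ℝ V => S e) h1
    simpa [c, map_sum, LinearMap.sum_apply] using h2
  have hxc : ∑ μ ∈ s, μ • c μ = x := by
    have h1 : aeval T (∑ μ ∈ s, C μ * Lagrange.basis s id μ) = aeval T (X : ℝ[X]) := by
      refine hT.aeval_eq_of_eval_eq fun ρ hρ => ?_
      rw [← hs] at hρ
      rw [eval_finsetSum, Finset.sum_eq_single ρ]
      · have := Lagrange.eval_basis_self hinj hρ
        simp only [id] at this
        simp [this]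
      · intro μ _ hne
        have := Lagrange.eval_basis_of_ne (v := (id : ℝ → ℝ)) hne hρ
        simp only [id] at this
        simp [this]
      · exact fun h => absurd hρ h
    have h2 := congrArg (fun S : Module.End ℝ V => S e) h1
    simpa [c, map_sum, LinearMap.sum_apply, T, jmul_e, Module.algebraMap_end_apply] using h2
  -- `c μ` is the projection of `e` onto the μ-eigenspace of `T`. It vanishes when that eigenspace
  -- is orthogonal to `e`, and such μ are discarded.
  let t : Finset ℝ := s.filter fun μ => c μ ≠ 0
  have ht : ∀ i : Fin t.card, ((t.equivFin.symm i : t) : ℝ) ∈ s ∧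
      c (t.equivFin.symm i : t) ≠ 0 := fun i => Finset.mem_filter.1 (t.equivFin.symm i).2
  have hreindex : ∀ g : ℝ → V, ∑ i : Fin t.card, g (t.equivFin.symm i : t) = ∑ μ ∈ t, g μ := by
    intro g
    rw [← Finset.sum_coe_sort t g]
    exact Equiv.sum_comp t.equivFin.symm fun μ : t => g μ
  refine ⟨t.card, fun i => (t.equivFin.symm i : t), fun i => c (t.equivFin.symm i : t),
    ⟨fun i => (ht i).2, fun i => ?_, fun i j hij => ?_, ?_⟩, ?_⟩
  · rw [hmul _ (ht i).1 _ (ht i).1, if_pos rfl]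
  · rw [hmul _ (ht i).1 _ (ht j).1, if_neg]
    intro h
    exact hij (t.equivFin.symm.injective (Subtype.ext h))
  · rw [hreindex c, ← hsum]
    exact Finset.sum_filter_ne_zero s
  · rw [hreindex fun μ => μ • c μ, ← hxc]
    refine (Finset.sum_subset (Finset.filter_subset _ s) fun μ hμ h => ?_).symm
    have : c μ = 0 := by
      by_contra h0
      exact h (Finset.mem_filter.2 ⟨hμ, h0⟩)
    rw [this, smul_zero]

/-- The spectral theorem for Euclidean Jordan algebras. -/
theorem exists_isSpectralDecomposition [FiniteDimensional ℝ V] (x : V) :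
    ∃ (k : ℕ) (lam : Fin k → ℝ) (q : Fin k → V), IsSpectralDecomposition x lam q := by
  classical
  -- A system of maximal length consists of primitive idempotents: splitting a member and repeating
  -- its coefficient would give a longer one. The dimension bounds the length.
  let S : Set ℕ := {k | ∃ (lam : Fin k → ℝ) (q : Fin k → V),
    IsIdempotentSystem q ∧ x = ∑ i, lam i • q i}
  have hne : S.Nonempty := exists_idempotentSystem x
  have hbdd : BddAbove S := ⟨Module.finrank ℝ V, fun k ⟨_, _, hq, _⟩ => hq.card_le⟩
  obtain ⟨lam, q, hq, hx⟩ := Nat.sSup_mem hne hbdd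
  refine ⟨sSup S, lam, q, ⟨fun i => ⟨hq.ne_zero i, hq.idem i, fun a b ha hb hab hi => ?_⟩,
    hq.orthogonal, hq.complete⟩, hx⟩
  by_contra! h
  have hmem : sSup S + 1 ∈ S := ⟨_, _, hq.split i ha hb hab hi h.1 h.2,
    hx.trans (sum_smul_split lam q i hi).symm⟩
  exact absurd (le_csSup hbdd hmem) (by omega)

end Algebra

/-! ### Eigenvalues and maximization over the simplex. -/

section Spectral

variable {V : Type*} [NormedAddCommGroup V] [InnerProductSpace ℝ V] [EuclideanJordanAlgebra V]
  {k : ℕ} {lam : Fin k → ℝ} {q : Fin k → V} {x : V}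

theorem IsJordanFrame.inner_of_ne (hq : IsJordanFrame q) {i j : Fin k} (h : i ≠ j) :
    ⟪q i, q j⟫ = 0 :=
  inner_eq_zero_of_jmul_eq_zero (hq.primitive i).idem (hq.orthogonal i j h)

theorem IsJordanFrame.inner_sum_smul (hq : IsJordanFrame q) (lam : Fin k → ℝ) (i : Fin k) :
    ⟪∑ j, lam j • q j, q i⟫ = lam i * ‖q i‖ ^ 2 := by
  rw [sum_inner, Finset.sum_eq_single i]
  · rw [real_inner_smul_left, real_inner_self_eq_norm_sq]
  · intro j _ h
    rw [real_inner_smul_left, hq.inner_of_ne h, mul_zero]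
  · simp

/-- If the coefficients are at most `M`, then so is the linear functional on the cone of squares,
relative to the trace. -/
theorem IsJordanFrame.inner_sum_smul_le (hq : IsJordanFrame q) {M : ℝ} (h : ∀ i, lam i ≤ M)
    {u : V} (hu : u ∈ squareCone V) : ⟪∑ j, lam j • q j, u⟫ ≤ M * ⟪e, u⟫ := by
  rw [← hq.complete, sum_inner, sum_inner, Finset.mul_sum]
  refine Finset.sum_le_sum fun i _ => ?_
  rw [real_inner_smul_left]
  exact mul_le_mul_of_nonneg_right (h i) (inner_idem_nonneg (hq.primitive i).idem hu)

/-- The inner product need not be the trace form, so a primitive idempotent need not have norm 1;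
the scaling comes from ⟨e, c⟩ = ‖c‖². -/
theorem normalized_mem_simplex {c : V} (hc : IsPrimitiveIdempotent c) :
    (‖c‖ ^ 2)⁻¹ • c ∈ simplex V := by
  have h0 : ‖c‖ ≠ 0 := norm_ne_zero_iff.2 hc.ne_zero
  refine ⟨⟨‖c‖⁻¹ • c, ?_⟩, ?_⟩
  · simp only [map_smul, LinearMap.smul_apply, hc.idem, smul_smul]
    congr 1
    field_simp
  · rw [real_inner_smul_right, inner_e_of_idem hc.idem]
    field_simp

theorem IsJordanFrame.inner_sum_smul_normalized (hq : IsJordanFrame q) (lam : Fin k → ℝ)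
    (i : Fin k) : ⟪∑ j, lam j • q j, (‖q i‖ ^ 2)⁻¹ • q i⟫ = lam i := by
  have h0 : ‖q i‖ ≠ 0 := norm_ne_zero_iff.2 (hq.primitive i).ne_zero
  rw [real_inner_smul_right, hq.inner_sum_smul]
  field_simp

/-- A coefficient in any other decomposition is the value of ⟨x, ·⟩ at a point of the simplex, hence
at most the largest coefficient of this one. Uniqueness of the decomposition is not needed. -/
theorem IsSpectralDecomposition.lambdaMax_eq (h : IsSpectralDecomposition x lam q) {i : Fin k}
    (hi : ∀ j, lam j ≤ lam i) : lambdaMax x = lam i := by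
  refine IsGreatest.csSup_eq ⟨⟨k, lam, q, h, i, rfl⟩, ?_⟩
  rintro t ⟨k', lam', q', h', i', rfl⟩
  have hu := normalized_mem_simplex (h'.1.primitive i')
  have h1 := h.1.inner_sum_smul_le hi hu.1
  rwa [hu.2, mul_one, ← h.2, h'.2, h'.1.inner_sum_smul_normalized] at h1

theorem IsSpectralDecomposition.exists_lambdaMax_eq (h : IsSpectralDecomposition x lam q)
    (he : (e : V) ≠ 0) : ∃ i, lambdaMax x = lam i ∧ ∀ j, lam j ≤ lam i := by
  have : Nonempty (Fin k) := by
    by_contra hk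
    rw [not_nonempty_iff] at hk
    exact he (by rw [← h.1.complete, Finset.univ_eq_empty, Finset.sum_empty])
  obtain ⟨i, hi⟩ := Finite.exists_max lam
  exact ⟨i, h.lambdaMax_eq hi, hi⟩

theorem IsSpectralDecomposition.mem_squareCone (h : IsSpectralDecomposition x lam q)
    (h0 : ∀ i, 0 ≤ lam i) : x ∈ squareCone V := by
  refine ⟨∑ i, √(lam i) • q i, ?_⟩
  rw [h.2, map_sum]
  refine Finset.sum_congr rfl fun i _ => ?_
  rw [map_sum, LinearMap.sum_apply, Finset.sum_eq_single i]
  · simp only [map_smul, LinearMap.smul_apply, (h.1.primitive i).idem, smul_smul,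
      Real.mul_self_sqrt (h0 i)]
  · intro j _ hj
    simp [h.1.orthogonal j i hj]
  · simp

theorem IsSpectralDecomposition.nonneg (h : IsSpectralDecomposition x lam q)
    (hx : ∀ u ∈ squareCone V, 0 ≤ ⟪x, u⟫) (i : Fin k) : 0 ≤ lam i := by
  have := hx _ (normalized_mem_simplex (h.1.primitive i)).1
  rwa [h.2, h.1.inner_sum_smul_normalized] at this

variable [FiniteDimensional ℝ V]

/-- The cone of squares contains its dual. -/
theorem mem_squareCone_of_forall_inner_nonneg (hx : ∀ u ∈ squareCone V, 0 ≤ ⟪x, u⟫) :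
    x ∈ squareCone V := by
  obtain ⟨k, lam, q, h⟩ := exists_isSpectralDecomposition x
  exact h.mem_squareCone (h.nonneg hx)

theorem exists_spectralMap_eq (g : ℝ → ℝ) (x : V) :
    ∃ (k : ℕ) (lam : Fin k → ℝ) (q : Fin k → V), IsSpectralDecomposition x lam q ∧
      spectralMap g x = ∑ i, g (lam i) • q i := by
  have h : ∃ d : (k : ℕ) × (Fin k → ℝ) × (Fin k → V),
      IsSpectralDecomposition x d.2.1 d.2.2 := by
    obtain ⟨k, lam, q, h⟩ := exists_isSpectralDecomposition x
    exact ⟨⟨k, lam, q⟩, h⟩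
  refine ⟨h.choose.1, h.choose.2.1, h.choose.2.2, h.choose_spec, ?_⟩
  rw [spectralMap, dif_pos h]

/-- The maximum of a linear functional over the simplex is the largest eigenvalue. -/
theorem isGreatest_lambdaMax (he : (e : V) ≠ 0) (x : V) :
    IsGreatest ((fun u : V => ⟪x, u⟫) '' simplex V) (lambdaMax x) := by
  obtain ⟨k, lam, q, h⟩ := exists_isSpectralDecomposition x
  obtain ⟨i, hi, hmax⟩ := h.exists_lambdaMax_eq he
  rw [hi]
  refine ⟨⟨_, normalized_mem_simplex (h.1.primitive i), ?_⟩, ?_⟩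
  · simp only [h.2]
    exact h.1.inner_sum_smul_normalized lam i
  · rintro _ ⟨u, hu, rfl⟩
    have := h.1.inner_sum_smul_le hmax hu.1
    rwa [hu.2, mul_one, ← h.2] at this

/-- A zero eigenvalue contributes the coefficient `Real.log 0 = 0`. The bound `1 ≤ lambdaMax x`
ensures that this does not exceed the logarithm of the largest eigenvalue. -/
theorem isGreatest_inner_jlog (hx : ∀ u ∈ squareCone V, 0 ≤ ⟪x, u⟫) (he : (e : V) ≠ 0)
    (h1 : 1 ≤ lambdaMax x) :
    IsGreatest ((fun u : V => ⟪jlog x, u⟫) '' simplex V) (Real.log (lambdaMax x)) := by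
  obtain ⟨k, lam, q, h, hlog⟩ := exists_spectralMap_eq Real.log x
  obtain ⟨i, hi, hmax⟩ := h.exists_lambdaMax_eq he
  rw [hi] at h1 ⊢
  have hle : ∀ j, Real.log (lam j) ≤ Real.log (lam i) := by
    intro j
    rcases (h.nonneg hx j).eq_or_lt with h0 | h0
    · rw [← h0, Real.log_zero]
      exact Real.log_nonneg h1
    · exact Real.log_le_log h0 (hmax j)
  refine ⟨⟨_, normalized_mem_simplex (h.1.primitive i), ?_⟩, ?_⟩
  · simp only [jlog, hlog]
    exact h.1.inner_sum_smul_normalized (fun j => Real.log (lam j)) i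
  · rintro _ ⟨u, hu, rfl⟩
    have := h.1.inner_sum_smul_le hle hu.1
    rwa [hu.2, mul_one, ← hlog] at this

end Spectral

end EuclideanJordanAlgebra

/-! ### Concavity and logarithmic homogeneity of f. -/

namespace LogHomProblem

variable {V W : Type*} [NormedAddCommGroup V] [InnerProductSpace ℝ V]
  [EuclideanJordanAlgebra V] [NormedAddCommGroup W] [NormedSpace ℝ W] (P : LogHomProblem V W)

theorem coe_toReal_f {y : W} (hy : y ∈ P.K₂) (h : P.f y ≠ ⊥) : ((P.f y).toReal : EReal) = P.f y :=
  EReal.coe_toReal (P.f_ne_top y hy) h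

/-- The effective domain of the objective `f`. -/
def effectiveDomain : Set W := {y | y ∈ P.K₂ ∧ P.f y ≠ ⊥}

theorem interior_subset_effectiveDomain : interior (P.K₂ : Set W) ⊆ P.effectiveDomain :=
  fun y hy => ⟨interior_subset hy, P.f_ne_bot y hy⟩

/-- The extended-real inequality also yields convexity of the domain, since a real lower bound
excludes `⊥`. -/
theorem concaveOn_toReal_f : ConcaveOn ℝ P.effectiveDomain (fun y => (P.f y).toReal) := by
  have key : ∀ y ∈ P.effectiveDomain, ∀ z ∈ P.effectiveDomain, ∀ a b : ℝ, 0 < a → 0 < b →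
      a + b = 1 → a • y + b • z ∈ P.effectiveDomain ∧
        a • (P.f y).toReal + b • (P.f z).toReal ≤ (P.f (a • y + b • z)).toReal := by
    intro y hy z hz a b ha hb hab
    have h := P.f_concave y hy.1 z hz.1 a b ha hb hab
    have hmem : a • y + b • z ∈ P.K₂ := P.K₂.convex hy.1 hz.1 ha.le hb.le hab
    rw [← P.coe_toReal_f hy.1 hy.2, ← P.coe_toReal_f hz.1 hz.2, ← EReal.coe_mul, ← EReal.coe_mul,
      ← EReal.coe_add] at h
    have hbot : P.f (a • y + b • z) ≠ ⊥ := fun h0 => by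
      rw [h0, le_bot_iff] at h
      exact EReal.coe_ne_bot _ h
    rw [← P.coe_toReal_f hmem hbot, EReal.coe_le_coe_iff] at h
    exact ⟨⟨hmem, hbot⟩, h⟩
  exact ⟨convex_iff_forall_pos.2 fun y hy z hz a b ha hb hab => (key y hy z hz a b ha hb hab).1,
    fun y hy z hz a b ha hb hab => by
      rcases ha.eq_or_lt with rfl | ha
      · obtain rfl : b = 1 := by linarith
        simp
      · rcases hb.eq_or_lt with rfl | hb
        · obtain rfl : a = 1 := by linarith
          simp
        · exact (key y hy z hz a b ha hb hab).2⟩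

/-- Concave functions lie below their tangents. -/
theorem toReal_f_le_add_fderiv {y z : W} (hy : y ∈ interior (P.K₂ : Set W))
    (hz : z ∈ P.effectiveDomain) :
    (P.f z).toReal ≤ (P.f y).toReal + fderiv ℝ (fun w => (P.f w).toReal) y (z - y) := by
  have hc := P.concaveOn_toReal_f.comp_affineMap (AffineMap.lineMap y z)
  have hd : HasDerivAt ((fun w => (P.f w).toReal) ∘ AffineMap.lineMap y z)
      (fderiv ℝ (fun w => (P.f w).toReal) y (z - y)) (0 : ℝ) := by
    have h1 : HasDerivAt (AffineMap.lineMap y z : ℝ → W) (z - y) 0 := AffineMap.hasDerivAt_lineMap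
    have h2 := (P.f_diff y hy).1.hasFDerivAt
    rw [← AffineMap.lineMap_apply_zero (k := ℝ) y z] at h2
    simpa using h2.comp_hasDerivAt (0 : ℝ) h1
  have h := hc.slope_le_of_hasDerivAt (x := 0) (y := 1)
    (by simpa using P.interior_subset_effectiveDomain hy) (by simpa using hz) one_pos hd
  simp only [slope_def_field, Function.comp_apply, AffineMap.lineMap_apply_zero,
    AffineMap.lineMap_apply_one, sub_zero, div_one] at h
  linarith

theorem toReal_f_smul {y : W} (hy : y ∈ interior (P.K₂ : Set W)) {t : ℝ} (ht : 0 < t) :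
    (P.f (t • y)).toReal = (P.f y).toReal + Real.log t := by
  rw [P.f_logHom y hy t ht, ← P.coe_toReal_f (interior_subset hy) (P.f_ne_bot y hy),
    ← EReal.coe_add, EReal.toReal_coe, EReal.toReal_coe]

/-- Euler's identity for logarithmically homogeneous functions. -/
theorem fderiv_f_self {y : W} (hy : y ∈ interior (P.K₂ : Set W)) :
    fderiv ℝ (fun w => (P.f w).toReal) y y = 1 := by
  have h1 : HasDerivAt (fun t : ℝ => t • y) y 1 := by
    simpa using (hasDerivAt_id (1 : ℝ)).smul_const y
  have h2 := (P.f_diff y hy).1.hasFDerivAt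
  rw [← one_smul ℝ y] at h2
  have h3 := h2.comp_hasDerivAt (1 : ℝ) h1
  rw [one_smul] at h3
  have h4 : HasDerivAt (fun t : ℝ => (P.f y).toReal + Real.log t) 1 1 := by
    simpa using (Real.hasDerivAt_log one_ne_zero).const_add (P.f y).toReal
  refine h3.unique (h4.congr_of_eventuallyEq ?_)
  filter_upwards [lt_mem_nhds (zero_lt_one (α := ℝ))] with t ht
  exact P.toReal_f_smul hy ht

open scoped Pointwise in
theorem smul_mem_interior {y : W} (hy : y ∈ interior (P.K₂ : Set W)) {t : ℝ} (ht : 0 < t) :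
    t • y ∈ interior (P.K₂ : Set W) := by
  have h : t • interior (P.K₂ : Set W) ⊆ interior (P.K₂ : Set W) := by
    rw [← interior_smul₀ ht.ne']
    refine interior_mono ?_
    rintro _ ⟨z, hz, rfl⟩
    exact P.K₂.smul_mem ht hz
  exact h (Set.smul_mem_smul_set hy)

/-- Scaling z by exp(-d) brings it to the level set of f through y. There the tangent inequality and
Euler's identity leave 1 ≤ exp(-d) f'(y)z. -/
theorem exp_le_fderiv_of_mem_interior {y z : W} (hy : y ∈ interior (P.K₂ : Set W))
    (hz : z ∈ interior (P.K₂ : Set W)) :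
    Real.exp ((P.f z).toReal - (P.f y).toReal) ≤ fderiv ℝ (fun w => (P.f w).toReal) y z := by
  set d := (P.f z).toReal - (P.f y).toReal with hd
  have hpos := Real.exp_pos (-d)
  have h := P.toReal_f_le_add_fderiv hy
    (P.interior_subset_effectiveDomain (P.smul_mem_interior hz hpos))
  rw [P.toReal_f_smul hz hpos, Real.log_exp, map_sub, P.fderiv_f_self hy, map_smul,
    smul_eq_mul] at h
  have h1 : 1 ≤ Real.exp (-d) * fderiv ℝ (fun w => (P.f w).toReal) y z := by linarith
  calc Real.exp d = Real.exp d * 1 := (mul_one _).symm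
    _ ≤ Real.exp d * (Real.exp (-d) * fderiv ℝ (fun w => (P.f w).toReal) y z) := by gcongr
    _ = _ := by rw [← mul_assoc, ← Real.exp_add, add_neg_cancel, Real.exp_zero, one_mul]

theorem combo_mem_interior {y z : W} (hy : y ∈ interior (P.K₂ : Set W)) (hz : z ∈ P.K₂) {t : ℝ}
    (ht : 0 < t) (ht1 : t < 1) : t • y + (1 - t) • z ∈ interior (P.K₂ : Set W) :=
  P.K₂.convex.combo_interior_self_mem_interior hy hz ht (by linarith) (by ring)

/-- Here f z may be -∞, so only positivity of the exponential is kept at the interior points ty + (1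
- t)z, and t tends to 0. -/
theorem fderiv_f_nonneg {y z : W} (hy : y ∈ interior (P.K₂ : Set W)) (hz : z ∈ P.K₂) :
    0 ≤ fderiv ℝ (fun w => (P.f w).toReal) y z := by
  set g := fderiv ℝ (fun w => (P.f w).toReal) y with hg
  have hc : Continuous fun t : ℝ => t + (1 - t) * g z := by fun_prop
  have hlim := (hc.tendsto 0).mono_left (nhdsWithin_le_nhds (s := Set.Ioi 0))
  simp only [zero_add, sub_zero, one_mul] at hlim
  refine ge_of_tendsto hlim ?_
  filter_upwards [Ioo_mem_nhdsGT (zero_lt_one (α := ℝ))] with t ht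
  have h := (Real.exp_pos _).le.trans
    (P.exp_le_fderiv_of_mem_interior hy (P.combo_mem_interior hy hz ht.1 ht.2))
  rwa [map_add, map_smul, map_smul, P.fderiv_f_self hy, smul_eq_mul, smul_eq_mul, mul_one] at h

/-- Homogeneity is available only in the interior, so a boundary z is approached along the segment
from y, where concavity bounds the increase of f below by (1 - t)(f z - f y). -/
theorem exp_le_fderiv {y z : W} (hy : y ∈ interior (P.K₂ : Set W)) (hz : z ∈ P.effectiveDomain) :
    Real.exp ((P.f z).toReal - (P.f y).toReal) ≤ fderiv ℝ (fun w => (P.f w).toReal) y z := by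
  set g := fderiv ℝ (fun w => (P.f w).toReal) y with hg
  have hc : Continuous fun t : ℝ => t + (1 - t) * g z := by fun_prop
  have hc' : Continuous fun t : ℝ => Real.exp ((1 - t) * ((P.f z).toReal - (P.f y).toReal)) := by
    fun_prop
  have hlim := (hc.tendsto 0).mono_left (nhdsWithin_le_nhds (s := Set.Ioi 0))
  have hlim' := (hc'.tendsto 0).mono_left (nhdsWithin_le_nhds (s := Set.Ioi 0))
  simp only [zero_add, sub_zero, one_mul] at hlim hlim'
  refine le_of_tendsto_of_tendsto hlim' hlim ?_
  filter_upwards [Ioo_mem_nhdsGT (zero_lt_one (α := ℝ))] with t ht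
  have h := P.exp_le_fderiv_of_mem_interior hy (P.combo_mem_interior hy hz.1 ht.1 ht.2)
  rw [map_add, map_smul, map_smul, P.fderiv_f_self hy, smul_eq_mul, smul_eq_mul, mul_one] at h
  refine le_trans (Real.exp_le_exp.2 ?_) h
  have hconc := P.concaveOn_toReal_f.2 (P.interior_subset_effectiveDomain hy) hz ht.1.le
    (sub_nonneg.2 ht.2.le) (by ring)
  simp only [smul_eq_mul] at hconc
  linarith

/-! ### The gradient of F and the gap bound. -/

variable [FiniteDimensional ℝ V]

theorem inner_gradF {x : V} (hx : x ∈ interior (squareCone V)) (u : V) :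
    ⟪P.gradF x, u⟫ = fderiv ℝ (fun w => (P.f w).toReal) (P.A x) (P.A u) := by
  have : CompleteSpace V := FiniteDimensional.complete ℝ V
  let A' : V →L[ℝ] W := LinearMap.toContinuousLinearMap P.A
  have h : HasFDerivAt (fun z => (P.F z).toReal)
      ((fderiv ℝ (fun w => (P.f w).toReal) (P.A x)).comp A') x :=
    ((P.f_diff _ (P.A_interior x hx)).1.hasFDerivAt (x := A' x)).comp x A'.hasFDerivAt
  rw [gradF, inner_gradient_left, h.fderiv]
  rfl

theorem inner_gradF_nonneg {x u : V} (hx : x ∈ interior (squareCone V)) (hu : u ∈ squareCone V) :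
    0 ≤ ⟪P.gradF x, u⟫ := by
  rw [P.inner_gradF hx]
  exact P.fderiv_f_nonneg (P.A_interior x hx) (P.A_mem u hu)

theorem inner_gradF_self {x : V} (hx : x ∈ interior (squareCone V)) : ⟪P.gradF x, x⟫ = 1 := by
  rw [P.inner_gradF hx, P.fderiv_f_self (P.A_interior x hx)]

theorem gap_le {x u : V} (hx : x ∈ interior (squareCone V)) (hu : u ∈ squareCone V) :
    P.gap u x ≤ elog ⟪P.gradF x, u⟫ := by
  have hAx := P.A_interior x hx
  have hdx := P.interior_subset_effectiveDomain hAx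
  rw [gap, F, F]
  by_cases hbot : P.f (P.A u) = ⊥
  · rw [hbot, EReal.bot_sub]
    exact bot_le
  · have hdu : P.A u ∈ P.effectiveDomain := ⟨P.A_mem u hu, hbot⟩
    have h := P.exp_le_fderiv hAx hdu
    rw [← P.inner_gradF hx] at h
    rw [← P.coe_toReal_f hdu.1 hdu.2, ← P.coe_toReal_f hdx.1 hdx.2, ← EReal.coe_sub, elog,
      ENNReal.log_ofReal_of_pos ((Real.exp_pos _).trans_le h), EReal.coe_le_coe_iff]
    exact (Real.le_log_iff_exp_le ((Real.exp_pos _).trans_le h)).2 h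

end LogHomProblem

theorem elog_mono : Monotone elog :=
  fun _ _ h => ENNReal.log_monotone (ENNReal.ofReal_le_ofReal h)

theorem mainTheorem7 {V W : Type*} [NormedAddCommGroup V] [InnerProductSpace ℝ V]
    [FiniteDimensional ℝ V] [EuclideanJordanAlgebra V]
    [NormedAddCommGroup W] [NormedSpace ℝ W] [FiniteDimensional ℝ W]
    (P : LogHomProblem V W) (x : V) (hx : x ∈ riSimplex V) :
    P.gradF x ∈ squareCone V ∧
    (∀ xstar ∈ P.optimalSet, P.gap xstar x ≤ elog ⟪P.gradF x, xstar⟫) ∧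
    (∀ xstar ∈ P.optimalSet, P.gap xstar x ≤ elog (lambdaMax (P.gradF x))) ∧
    IsGreatest ((fun u : V => elog ⟪P.gradF x, u⟫) '' simplex V)
      (elog (lambdaMax (P.gradF x))) ∧
    IsGreatest ((fun u : V => ((⟪jlog (P.gradF x), u⟫ : ℝ) : EReal)) '' simplex V)
      (elog (lambdaMax (P.gradF x))) := by
  obtain ⟨hxi, hx1⟩ := hx
  have he : (e : V) ≠ 0 := by
    rintro h
    rw [h, inner_zero_left] at hx1
    exact zero_ne_one hx1
  have hnonneg : ∀ u ∈ squareCone V, 0 ≤ ⟪P.gradF x, u⟫ := fun u hu => P.inner_gradF_nonneg hxi hu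
  have hmax := isGreatest_lambdaMax he (P.gradF x)
  -- The point x itself lies in the simplex and pairs to 1 with the gradient.
  have hone : 1 ≤ lambdaMax (P.gradF x) :=
    hmax.2 ⟨x, ⟨interior_subset hxi, hx1⟩, P.inner_gradF_self hxi⟩
  refine ⟨mem_squareCone_of_forall_inner_nonneg hnonneg, fun s hs => P.gap_le hxi hs.1.1,
    fun s hs => (P.gap_le hxi hs.1.1).trans (elog_mono (hmax.2 ⟨s, hs.1, rfl⟩)), ?_, ?_⟩
  · have := elog_mono.map_isGreatest hmax
    rwa [Set.image_image] at this
  · have := EReal.coe_strictMono.monotone.map_isGreatest (isGreatest_inner_jlog hnonneg he hone)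
    rwa [Set.image_image, ← ENNReal.log_ofReal_of_pos (zero_lt_one.trans_le hone)] at this
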